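/- Let $0<a<1$ and $\Omega_a=\{z\in\mathbb{C} : a<|z|\le 1\}$, and let $g=e^{2u}|dz|^2$ be a conformal metric on $\Omega_a$, where $u:\Omega_a\to\mathbb{R}$ is continuous on $\Omega_a$ and of class $C^2$ on the interior $\{a<|z|<1\}$ (for instance, $u$ smooth on $\Omega_a$). Suppose that - $g$ is flat, i.e. its Gauss curvature $K=-e^{-2u}\Delta u$ vanishes on $\{a<|z|<1\}$, and - $g$ has positive width, i.e. $l_0(g)=\inf_\gamma L_g(\gamma)>0$, where $\gamma$ runs over all piecewise smooth closed curves $\gamma:S^1\to\Omega_a$ that are not null-homotopic in $\Omega_a$, and $L_g$ denotes $g$-length. Then $g$ is not complete: $\Omega_a$ with the Riemannian distance $d_g(p,q)=\inf\{L_g(c) : c \text{ a piecewise smooth curve in } \Omega_a \text{ from } p \text{ to } q\}$ is not a complete metric space. -/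

import Mathlib

open Set Filter Topology MeasureTheory
open scoped ENNReal ContDiff

noncomputable section

namespace ConformalAnnulus

/-- The half-closed annulus `{z : a < |z| ≤ 1}`, a surface with boundary the unit circle. -/
def annulus (a : ℝ) : Set ℂ := {z | a < ‖z‖ ∧ ‖z‖ ≤ 1}

/-- The interior `{z : a < |z| < 1}` of the annulus. -/
def openAnnulus (a : ℝ) : Set ℂ := {z | a < ‖z‖ ∧ ‖z‖ < 1}

/-- The conformal Riemannian metric `g = e^{2u} |dz|²`, evaluated at the point `z` on the
tangent vectors `v` and `w`. -/
def metric (u : ℂ → ℝ) (z v w : ℂ) : ℝ := Real.exp (2 * u z) * inner ℝ v w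

/-- The Gauss curvature `K = -e^{-2u} Δu` of the conformal metric `e^{2u} |dz|²`. -/
def gaussCurvature (u : ℂ → ℝ) (z : ℂ) : ℝ :=
  -(Real.exp (-2 * u z) * Laplacian.laplacian u z)

/-- The metric `e^{2u} |dz|²` on the annulus is flat: its Gauss curvature vanishes at every
interior point. -/
def IsFlat (a : ℝ) (u : ℂ → ℝ) : Prop := ∀ z ∈ openAnnulus a, gaussCurvature u z = 0

/-- `c` restricted to `[0, 1]` is a piecewise smooth curve: it is continuous, and `[0, 1]` has a
finite subdivision on each closed interval of which `c` is smooth (up to the end points). -/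
def IsPiecewiseSmooth (c : ℝ → ℂ) : Prop :=
  ContinuousOn c (Icc 0 1) ∧
    ∃ (n : ℕ) (t : Fin (n + 1) → ℝ), StrictMono t ∧ t 0 = 0 ∧ t (Fin.last n) = 1 ∧
      ∀ i : Fin n, ContDiffOn ℝ ∞ c (Icc (t i.castSucc) (t i.succ))

/-- The length `∫₀¹ √(g(c', c')) dt` of a curve `c : [0, 1] → ℂ` for `g = e^{2u} |dz|²`. (For a
piecewise smooth curve, `deriv c t` is the velocity at all but finitely many `t`.) -/
def length (u : ℂ → ℝ) (c : ℝ → ℂ) : ℝ≥0∞ :=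
  ∫⁻ t in Icc (0 : ℝ) 1, ENNReal.ofReal (Real.sqrt (metric u (c t) (deriv c t) (deriv c t)))

/-- The `1`-periodic parametrization of a closed curve in the annulus. -/
def param {a : ℝ} (γ : C(UnitAddCircle, annulus a)) (t : ℝ) : ℂ := (γ (t : UnitAddCircle) : ℂ)

/-- The piecewise smooth closed curves `S¹ → Ω_a` that are homotopically nontrivial, i.e. not
freely homotopic in the annulus to a constant curve. -/
def nontrivialLoops (a : ℝ) : Set C(UnitAddCircle, annulus a) :=
  {γ | IsPiecewiseSmooth (param γ) ∧ ¬ γ.Nullhomotopic}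

/-- The width `l₀(g)` of the annulus: the infimum of the `g`-lengths of the homotopically
nontrivial piecewise smooth closed curves. -/
def width (a : ℝ) (u : ℂ → ℝ) : ℝ≥0∞ := ⨅ γ ∈ nontrivialLoops a, length u (param γ)

/-- The piecewise smooth curves in the annulus from `p` to `q`. -/
def curvesBetween (a : ℝ) (p q : ℂ) : Set (ℝ → ℂ) :=
  {c | IsPiecewiseSmooth c ∧ MapsTo c (Icc 0 1) (annulus a) ∧ c 0 = p ∧ c 1 = q}

/-- The Riemannian distance `d_g` on the annulus. -/
def riemDist (a : ℝ) (u : ℂ → ℝ) (p q : annulus a) : ℝ≥0∞ :=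
  ⨅ c ∈ curvesBetween a p q, length u c

/-- The metric `e^{2u} |dz|²` on the annulus is complete: every Cauchy sequence for the
Riemannian distance converges, for this distance, to a point of the annulus. -/
def IsCompleteMetric (a : ℝ) (u : ℂ → ℝ) : Prop :=
  ∀ x : ℕ → annulus a,
    (∀ ε : ℝ≥0∞, 0 < ε → ∃ N, ∀ m ≥ N, ∀ n ≥ N, riemDist a u (x m) (x n) < ε) →
      ∃ p : annulus a, Tendsto (fun n => riemDist a u (x n) p) atTop (𝓝 0)

end ConformalAnnulus

end

noncomputable section

namespace ConformalAnnulus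

/-! Flatness makes `u` harmonic, so on the strip `log a < Re ζ < 0`, which `exp` maps onto the open
annulus, `u ∘ exp = Re H` with `H` holomorphic (`exists_holomorphic_re_eq`). A primitive `F` of `exp
(H + id)` is then a developing map: `|F'| = e^u |exp|`, so `F` is a local isometry from the
pulled-back metric to the Euclidean plane.

Suppose the metric is complete, and fix `a < ρ < 1` with `u ≥ m` on `ρ ≤ |z| ≤ 1`. Getting from `|z|
< ρ` to the unit circle costs at least `R = e^m (1 - ρ)`. Hence a segment of length less than `R`,
starting at the image under `F` of a point over `|z| < ρ`, lifts through `F`: completeness gives the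
partial lift an end point in the annulus, and the cost estimate keeps it off the unit circle
(`exists_tendsto_of_lift`). So `F` has a holomorphic local inverse on a whole disc of radius `R`.
Its values satisfy `Re > log a`, and Schwarz-Pick bounds its derivative `1/F'` at the centre by `2
(Re ζ₀ - log a) / R` (`le_norm_deriv_of_isCompleteMetric`). Thus `u → +∞` at the inner circle.

A harmonic function cannot do that while staying continuous up to the outer circle
(`not_tendsto_atTop_inner`): by the minimum principle `u + N log |z|` would be bounded below by the
minimum of `u` on the unit circle for every `N ≥ 0`, which is absurd because `log |z| < 0` inside.
-/

/-- The vertical strip which `Complex.exp` maps onto the open annulus. -/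
def strip (a : ℝ) : Set ℂ := {ζ | Real.log a < ζ.re ∧ ζ.re < 0}

lemma isOpen_strip (a : ℝ) : IsOpen (strip a) :=
  (isOpen_lt continuous_const Complex.continuous_re).inter
    (isOpen_lt Complex.continuous_re continuous_const)

lemma convex_strip (a : ℝ) : Convex ℝ (strip a) :=
  (convex_halfSpace_re_gt _).inter (convex_halfSpace_re_lt _)

lemma isOpen_openAnnulus (a : ℝ) : IsOpen (openAnnulus a) :=
  (isOpen_lt continuous_const continuous_norm).inter (isOpen_lt continuous_norm continuous_const)

lemma openAnnulus_subset (a : ℝ) : openAnnulus a ⊆ annulus a := fun _ hz => ⟨hz.1, hz.2.le⟩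

lemma exp_mem_openAnnulus_iff {a : ℝ} (ha : 0 < a) {ζ : ℂ} :
    Complex.exp ζ ∈ openAnnulus a ↔ ζ ∈ strip a := by
  simp only [openAnnulus, strip, mem_ofPred_eq, Complex.norm_exp, Real.exp_lt_one_iff,
    Real.log_lt_iff_lt_exp ha]

/-! ### Primitives, and harmonic functions as real parts -/

/-- A holomorphic function on a convex open set has a primitive. -/
lemma exists_primitive_of_convex {s : Set ℂ} (hs : Convex ℝ s) (hso : IsOpen s) {f : ℂ → ℂ}
    (hf : DifferentiableOn ℂ f s) : ∃ F : ℂ → ℂ, ∀ z ∈ s, HasDerivAt F (f z) z := by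
  have hfd : ∀ z ∈ s, HasFDerivAt (fun z => ContinuousLinearMap.toSpanSingleton ℂ (f z))
      (((ContinuousLinearMap.toSpanSingletonCLE (𝕜 := ℂ) (E := ℂ) : ℂ →L[ℂ] ℂ →L[ℂ] ℂ).restrictScalars ℝ).comp
        ((ContinuousLinearMap.toSpanSingleton ℂ (deriv f z)).restrictScalars ℝ)) z := by
    intro z hz
    have h1 := ((hf.differentiableAt (hso.mem_nhds hz)).hasDerivAt.hasFDerivAt).restrictScalars ℝ
    exact (((ContinuousLinearMap.toSpanSingletonCLE (𝕜 := ℂ) (E := ℂ) :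
      ℂ →L[ℂ] ℂ →L[ℂ] ℂ).restrictScalars ℝ).hasFDerivAt).comp z h1
  obtain ⟨F, hF⟩ : ∃ F : ℂ → ℂ, ∀ z ∈ s, HasFDerivAt F
      (ContinuousLinearMap.toSpanSingleton ℂ (f z)) z :=
    -- Poincaré lemma for the 1-form `f dz`: it is closed because its derivative `(x, y) ↦ f'(z) x
    -- y` is symmetric.
    hs.exists_forall_hasFDerivAt_of_fderiv_symmetric hso
    (fun z hz => (hfd z hz).differentiableAt.differentiableWithinAt) (by
      intro z hz x y
      rw [(hfd z hz).fderiv]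
      simp
      ring)
  exact ⟨F, fun z hz => hF z hz⟩

lemma harmonicAt_of_isFlat {a : ℝ} {u : ℂ → ℝ} (hu2 : ContDiffOn ℝ 2 u (openAnnulus a))
    (hflat : IsFlat a u) {z : ℂ} (hz : z ∈ openAnnulus a) : InnerProductSpace.HarmonicAt u z := by
  refine ⟨hu2.contDiffAt ((isOpen_openAnnulus a).mem_nhds hz), ?_⟩
  filter_upwards [(isOpen_openAnnulus a).mem_nhds hz] with w hw
  have := hflat w hw
  simpa [gaussCurvature, Real.exp_ne_zero] using this

/-- The lift of a harmonic function on the annulus to the strip is the real part of a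
holomorphic function. -/
lemma exists_holomorphic_re_eq {a : ℝ} (ha : 0 < a) {u : ℂ → ℝ}
    (hu : ∀ z ∈ openAnnulus a, InnerProductSpace.HarmonicAt u z) :
    ∃ H : ℂ → ℂ, DifferentiableOn ℂ H (strip a) ∧
      ∀ ζ ∈ strip a, (H ζ).re = u (Complex.exp ζ) := by
  -- `g = 2 ∂u/∂z` is holomorphic because `u` is harmonic, and `g (exp ζ) * exp ζ` is twice the
  -- `∂/∂ζ` derivative of `u ∘ exp`.
  set g : ℂ → ℂ := fun z => fderiv ℝ u z 1 - Complex.I * fderiv ℝ u z Complex.I with hg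
  have hdiff : DifferentiableOn ℂ (fun ζ => g (Complex.exp ζ) * Complex.exp ζ) (strip a) := by
    intro ζ hζ
    have h1 : DifferentiableAt ℂ g (Complex.exp ζ) :=
      HarmonicAt.differentiableAt_complex_partial (hu _ ((exp_mem_openAnnulus_iff ha).2 hζ))
    exact ((h1.comp ζ Complex.differentiableAt_exp).mul
      Complex.differentiableAt_exp).differentiableWithinAt
  obtain ⟨H, hH⟩ := exists_primitive_of_convex (convex_strip a) (isOpen_strip a) hdiff
  have hzero : ∀ ζ ∈ strip a, HasFDerivAt (fun ζ : ℂ => u (Complex.exp ζ) - (H ζ).re)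
      (0 : ℂ →L[ℝ] ℝ) ζ := by
    intro ζ hζ
    have h1 : HasFDerivAt u (fderiv ℝ u (Complex.exp ζ)) (Complex.exp ζ) :=
      ((hu _ ((exp_mem_openAnnulus_iff ha).2 hζ)).1.differentiableAt two_ne_zero).hasFDerivAt
    have h2 := h1.comp ζ ((Complex.hasDerivAt_exp ζ).hasFDerivAt.restrictScalars ℝ)
    have h3 := Complex.reCLM.hasFDerivAt.comp ζ ((hH ζ hζ).hasFDerivAt.restrictScalars ℝ)
    refine (h2.sub h3).congr_fderiv (ContinuousLinearMap.ext fun v => ?_)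
    set w : ℂ := v * Complex.exp ζ with hw
    have h4 : fderiv ℝ u (Complex.exp ζ) w = w.re * fderiv ℝ u (Complex.exp ζ) 1
        + w.im * fderiv ℝ u (Complex.exp ζ) Complex.I := by
      conv_lhs => rw [show w = w.re • (1 : ℂ) + w.im • Complex.I by simp]
      rw [map_add, map_smul, map_smul, smul_eq_mul, smul_eq_mul]
    have h5 : v * (g (Complex.exp ζ) * Complex.exp ζ) = g (Complex.exp ζ) * w := by
      rw [hw]; ring
    have h6 : (v * (g (Complex.exp ζ) * Complex.exp ζ)).re = fderiv ℝ u (Complex.exp ζ) w := by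
      rw [h5, h4, hg]
      simp
      ring
    simp [h6, ← hw]
  rcases (strip a).eq_empty_or_nonempty with he | ⟨ζ₀, hζ₀⟩
  · exact ⟨0, by simp [he], by simp [he]⟩
  have hconst : ∀ ζ ∈ strip a, u (Complex.exp ζ) - (H ζ).re
      = u (Complex.exp ζ₀) - (H ζ₀).re := fun ζ hζ =>
    (isOpen_strip a).is_const_of_fderiv_eq_zero (convex_strip a).isPreconnected
      (fun x hx => (hzero x hx).differentiableAt.differentiableWithinAt)
      (fun x hx => (hzero x hx).fderiv) hζ hζ₀
  refine ⟨fun ζ => H ζ + ((u (Complex.exp ζ₀) - (H ζ₀).re : ℝ) : ℂ), ?_, ?_⟩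
  · exact fun ζ hζ => ((hH ζ hζ).differentiableAt.add_const _).differentiableWithinAt
  · intro ζ hζ
    have := hconst ζ hζ
    simp only [Complex.add_re, Complex.ofReal_re]
    linarith

/-! ### Schwarz-Pick for a half-plane -/

/-- The Schwarz-Pick inequality at the centre, for maps of a disc to a right half-plane. -/
lemma norm_deriv_le_of_re_gt {G : ℂ → ℂ} {R α : ℝ} (hR : 0 < R)
    (hG : DifferentiableOn ℂ G (Metric.ball 0 R)) (hα : ∀ w ∈ Metric.ball 0 R, α < (G w).re) :
    ‖deriv G 0‖ ≤ 2 * ((G 0).re - α) / R := by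
  have h0 : (0 : ℂ) ∈ Metric.ball (0 : ℂ) R := Metric.mem_ball_self hR
  set p : ℂ := G 0 with hp
  -- `q` is the mirror image of `p` in the line `Re = α`, so the Cayley transform `Φ` below sends
  -- the half-plane into the unit disc and `p` to `0`.
  set q : ℂ := 2 * α - (starRingEnd ℂ) p with hq
  have hpα : 0 < p.re - α := by have := hα 0 h0; linarith
  have hne : ∀ w ∈ Metric.ball (0 : ℂ) R, G w - q ≠ 0 := by
    intro w hw h
    have h1 := congrArg Complex.re h
    simp [hq] at h1
    have := hα w hw
    linarith
  set Φ : ℂ → ℂ := fun w => (G w - p) / (G w - q) with hΦ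
  have hd : DifferentiableOn ℂ Φ (Metric.ball 0 R) :=
    (hG.sub_const p).div (hG.sub_const q) hne
  have hΦ0 : Φ 0 = 0 := by simp [hΦ, hp]
  have hmaps : MapsTo Φ (Metric.ball 0 R) (Metric.closedBall (Φ 0) 1) := by
    intro w hw
    rw [hΦ0, mem_closedBall_zero_iff, hΦ]
    simp only [norm_div]
    refine div_le_one_of_le₀ ?_ (norm_nonneg _)
    rw [← abs_of_nonneg (norm_nonneg (G w - p)), ← abs_of_nonneg (norm_nonneg (G w - q)),
      ← sq_le_sq, Complex.sq_norm, Complex.sq_norm, Complex.normSq_apply, Complex.normSq_apply]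
    have := hα w hw
    simp [hq]
    nlinarith
  have h1 := Complex.norm_deriv_le_div_of_mapsTo_ball hd hmaps hR
  have hGd : HasDerivAt G (deriv G 0) 0 :=
    (hG.differentiableAt (Metric.isOpen_ball.mem_nhds h0)).hasDerivAt
  have h2 : HasDerivAt Φ (deriv G 0 / (p - q)) 0 := by
    have := (hGd.sub_const p).div (hGd.sub_const q) (hne 0 h0)
    refine this.congr_deriv ?_
    have h3 := hne 0 h0
    rw [← hp] at h3 ⊢
    field_simp
    ring
  have hpq : p - q = ((2 * (p.re - α) : ℝ) : ℂ) := by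
    apply Complex.ext <;> simp [hq]
    ring
  rw [h2.deriv, norm_div, hpq, Complex.norm_real, Real.norm_of_nonneg (by positivity),
    div_le_iff₀ (by positivity)] at h1
  calc _ ≤ _ := h1
    _ = _ := by ring

/-! ### Lower bounds for lengths and distances -/

lemma enorm_sub_le_lintegral_deriv {c : ℝ → ℂ} (hc : IsPiecewiseSmooth c) {s t : ℝ}
    (hs : 0 ≤ s) (hst : s ≤ t) (ht : t ≤ 1) :
    ‖c t - c s‖ₑ ≤ ∫⁻ x in Ioo s t, ‖deriv c x‖ₑ := by
  obtain ⟨-, n, T, hT, hT0, hT1, hsm⟩ := hc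
  rw [restrict_Ioo_eq_restrict_Ioc]
  have key : ∀ i : Fin (n + 1), ∀ s t : ℝ, 0 ≤ s → s ≤ t → t ≤ T i →
      ‖c t - c s‖ₑ ≤ ∫⁻ x in Ioc s t, ‖deriv c x‖ₑ := by
    intro i
    induction i using Fin.induction with
    | zero =>
      intro s t hs hst ht
      obtain rfl : s = t := by linarith
      simp
    | succ i ih =>
      have hpiece : ∀ s t, T i.castSucc ≤ s → s ≤ t → t ≤ T i.succ →
          ‖c t - c s‖ₑ ≤ ∫⁻ x in Ioc s t, ‖deriv c x‖ₑ := by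
        intro s t hs hst ht
        rw [restrict_Ioc_eq_restrict_Icc]
        exact enorm_sub_le_lintegral_deriv_of_contDiffOn_Icc
          (((hsm i).of_le (mod_cast le_top)).mono (Icc_subset_Icc hs ht)) hst
      intro s t hs hst ht
      rcases le_total t (T i.castSucc) with h | h
      · exact ih s t hs hst h
      rcases le_total (T i.castSucc) s with h' | h'
      · exact hpiece s t h' hst ht
      · rw [← Ioc_union_Ioc_eq_Ioc h' h, lintegral_union measurableSet_Ioc
          (Ioc_disjoint_Ioc_of_le le_rfl)]
        calc ‖c t - c s‖ₑ = ‖(c (T i.castSucc) - c s) + (c t - c (T i.castSucc))‖ₑ := by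
              congr 1; ring
          _ ≤ _ := (enorm_add_le _ _).trans
              (add_le_add (ih s _ hs h' le_rfl) (hpiece _ t le_rfl h ht))
  exact key (Fin.last n) s t hs hst (by rw [hT1]; exact ht)

lemma sqrt_metric_self (u : ℂ → ℝ) (z v : ℂ) :
    Real.sqrt (metric u z v v) = Real.exp (u z) * ‖v‖ := by
  rw [metric, real_inner_self_eq_norm_sq,
    show Real.exp (2 * u z) * ‖v‖ ^ 2 = (Real.exp (u z) * ‖v‖) ^ 2 by
      rw [mul_pow, ← Real.exp_nat_mul]; norm_num]
  exact Real.sqrt_sq (by positivity)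

lemma length_eq (u : ℂ → ℝ) (c : ℝ → ℂ) :
    length u c = ∫⁻ t in Icc (0 : ℝ) 1, ENNReal.ofReal (Real.exp (u (c t)) * ‖deriv c t‖) := by
  simp only [length, sqrt_metric_self]

/-- A curve crossing the region `α ≤ φ ≤ β`, where `φ` is `1`-Lipschitz and `u ≥ m`, has length
at least `e^m (β - α)`. -/
lemma le_length_of_crossing {a : ℝ} {u : ℂ → ℝ} {φ : ℂ → ℝ} (hφ : LipschitzWith 1 φ)
    {α β m : ℝ} (hm : ∀ z ∈ annulus a, α ≤ φ z → φ z ≤ β → m ≤ u z) {c : ℝ → ℂ}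
    (hc : IsPiecewiseSmooth c) (hca : MapsTo c (Icc 0 1) (annulus a))
    (h0 : φ (c 0) ≤ α) (h1 : β ≤ φ (c 1)) :
    ENNReal.ofReal (Real.exp m * (β - α)) ≤ length u c := by
  rcases le_or_gt β α with hαβ | hαβ
  · rw [ENNReal.ofReal_of_nonpos]
    · exact zero_le
    · exact mul_nonpos_of_nonneg_of_nonpos (Real.exp_pos _).le (by linarith)
  have hf : ContinuousOn (fun x => φ (c x)) (Icc 0 1) := hφ.continuous.comp_continuousOn hc.1
  have hA : IsCompact (Icc (0 : ℝ) 1 ∩ (fun x => φ (c x)) ⁻¹' Ici β) :=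
    isCompact_Icc.of_isClosed_subset (hf.preimage_isClosed_of_isClosed isClosed_Icc isClosed_Ici)
      inter_subset_left
  -- `t` is the first time with `φ ≥ β`, and `s` below the last time before `t` with `φ ≤ α`; in
  -- between the curve stays where `u ≥ m`.
  obtain ⟨t, ⟨ht, htβ⟩, htmin⟩ := hA.exists_isLeast ⟨1, by simp, h1⟩
  have hB : IsCompact (Icc (0 : ℝ) t ∩ (fun x => φ (c x)) ⁻¹' Iic α) :=
    isCompact_Icc.of_isClosed_subset ((hf.mono
      (Icc_subset_Icc_right ht.2)).preimage_isClosed_of_isClosed isClosed_Icc isClosed_Iic) inter_subset_left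
  obtain ⟨s, ⟨hs, hsα⟩, hsmax⟩ := hB.exists_isGreatest ⟨0, ⟨le_rfl, ht.1⟩, h0⟩
  have hmid : ∀ x ∈ Ioo s t, m ≤ u (c x) := by
    intro x hx
    have hx01 : x ∈ Icc (0 : ℝ) 1 := ⟨hs.1.trans hx.1.le, hx.2.le.trans ht.2⟩
    refine hm _ (hca hx01) ?_ ?_
    · by_contra! h
      exact absurd (hsmax ⟨⟨hx01.1, hx.2.le⟩, h.le⟩) (not_le.2 hx.1)
    · by_contra! h
      exact absurd (htmin ⟨hx01, h.le⟩) (not_le.2 hx.2)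
  have hdist : β - α ≤ ‖c t - c s‖ := by
    have h2 := hφ.dist_le_mul (c t) (c s)
    rw [NNReal.coe_one, one_mul, Real.dist_eq, dist_eq_norm] at h2
    have h3 := (le_abs_self _).trans h2
    have h4 : β ≤ φ (c t) := htβ
    have h5 : φ (c s) ≤ α := hsα
    linarith
  calc ENNReal.ofReal (Real.exp m * (β - α))
      ≤ ENNReal.ofReal (Real.exp m) * ‖c t - c s‖ₑ := by
        rw [ENNReal.ofReal_mul (Real.exp_pos _).le, ← ofReal_norm]
        gcongr
    _ ≤ ENNReal.ofReal (Real.exp m) * ∫⁻ x in Ioo s t, ‖deriv c x‖ₑ := by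
        gcongr
        exact enorm_sub_le_lintegral_deriv hc hs.1 hs.2 ht.2
    _ = ∫⁻ x in Ioo s t, ENNReal.ofReal (Real.exp m) * ‖deriv c x‖ₑ :=
        (lintegral_const_mul' _ _ ENNReal.ofReal_ne_top).symm
    _ ≤ ∫⁻ x in Ioo s t, ENNReal.ofReal (Real.exp (u (c x)) * ‖deriv c x‖) := by
        refine setLIntegral_mono' measurableSet_Ioo fun x hx => ?_
        rw [ENNReal.ofReal_mul (Real.exp_pos _).le, ofReal_norm]
        gcongr
        exact hmid x hx
    _ ≤ length u c := by
        rw [length_eq]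
        exact lintegral_mono_set fun x hx => ⟨hs.1.trans hx.1.le, hx.2.le.trans ht.2⟩

lemma le_riemDist_of_crossing {a : ℝ} {u : ℂ → ℝ} {φ : ℂ → ℝ} (hφ : LipschitzWith 1 φ)
    {α β m : ℝ} (hm : ∀ z ∈ annulus a, α ≤ φ z → φ z ≤ β → m ≤ u z) {p q : annulus a}
    (h0 : φ p ≤ α) (h1 : β ≤ φ q) :
    ENNReal.ofReal (Real.exp m * (β - α)) ≤ riemDist a u p q :=
  le_iInf₂ fun _ hc => le_length_of_crossing hφ hm hc.1 hc.2.1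
    (by rw [hc.2.2.1]; exact h0) (by rw [hc.2.2.2]; exact h1)

/-- Convergence for the Riemannian distance implies convergence in the plane. -/
lemma tendsto_of_tendsto_riemDist {a : ℝ} {u : ℂ → ℝ} (hu : ContinuousOn u (annulus a))
    {x : ℕ → annulus a} {q : annulus a}
    (h : Tendsto (fun n => riemDist a u (x n) q) atTop (𝓝 0)) :
    Tendsto (fun n => (x n : ℂ)) atTop (𝓝 (q : ℂ)) := by
  rw [Metric.tendsto_atTop]
  intro ε hε
  obtain ⟨δ, hδ, hu'⟩ := Metric.continuousWithinAt_iff.1 (hu q q.2) 1 one_pos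
  set r := min ε (δ / 2) with hr
  have hr0 : 0 < r := lt_min hε (by positivity)
  -- The sign makes `φ` increase towards `q`, where it is `0`; `r ≤ δ / 2` keeps the crossed region
  -- inside the disc on which `u > u q - 1`.
  have hφ : LipschitzWith 1 fun z : ℂ => -dist z q := (LipschitzWith.dist_left (q : ℂ)).neg
  have hm : ∀ z ∈ annulus a, -r ≤ -dist z (q : ℂ) → -dist z (q : ℂ) ≤ 0 → u q - 1 ≤ u z := by
    intro z hz h1 _
    have h2 := hu' hz (by have := min_le_right ε (δ / 2); rw [← hr] at this; linarith)
    rw [Real.dist_eq, abs_lt] at h2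
    linarith
  have hpos : 0 < ENNReal.ofReal (Real.exp (u q - 1) * (0 - -r)) :=
    ENNReal.ofReal_pos.2 (mul_pos (Real.exp_pos _) (by linarith))
  obtain ⟨N, hN⟩ := eventually_atTop.1 (h.eventually_lt_const hpos)
  refine ⟨N, fun n hn => ?_⟩
  by_contra! hcon
  refine absurd (hN n hn) (not_lt.2 (le_riemDist_of_crossing hφ hm ?_ ?_))
  · exact neg_le_neg ((min_le_left _ _).trans hcon)
  · simp

/-! ### The developing map as a local isometry -/

lemma mul_deriv_eq_of_lift {F : ℂ → ℂ} {γ : ℝ → ℂ} {τ : ℝ} {F' z w : ℂ}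
    (hF : HasDerivAt F F' (γ τ)) (hγ : DifferentiableAt ℝ γ τ)
    (hline : ∀ᶠ x in 𝓝 τ, F (γ x) = z + x • w) : F' * deriv γ τ = w := by
  have h1 : HasDerivAt (fun x => F (γ x)) (F' * deriv γ τ) τ :=
    hF.comp_of_eq τ hγ.hasDerivAt rfl
  have h2 : HasDerivAt (fun x : ℝ => z + x • w) w τ := by
    simpa using ((hasDerivAt_id τ).smul_const w).const_add z
  exact h1.unique (h2.congr_of_eventuallyEq hline)

/-- The image under `exp` of a curve in the strip whose image under the developing map `F` is a
segment has the length of that segment. -/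
lemma riemDist_exp_le {a : ℝ} (ha : 0 < a) {u : ℂ → ℝ} {F F' : ℂ → ℂ}
    (hF : ∀ ζ ∈ strip a, HasDerivAt F (F' ζ) ζ)
    (hF' : ∀ ζ ∈ strip a, ‖F' ζ‖ = Real.exp (u (Complex.exp ζ)) * ‖Complex.exp ζ‖)
    {γ : ℝ → ℂ} {A B : ℝ} (hγ : ContDiffOn ℝ ∞ γ (Ioo A B)) (hγS : MapsTo γ (Ioo A B) (strip a))
    {z w : ℂ} (hline : ∀ τ ∈ Ioo A B, F (γ τ) = z + τ • w) {s t : ℝ} (hs : s ∈ Ioo A B)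
    (ht : t ∈ Ioo A B) {p q : annulus a} (hp : (p : ℂ) = Complex.exp (γ s))
    (hq : (q : ℂ) = Complex.exp (γ t)) :
    riemDist a u p q ≤ ENNReal.ofReal (‖w‖ * |t - s|) := by
  set ℓ : ℝ → ℝ := fun x => s + x * (t - s) with hℓ
  have hℓI : MapsTo ℓ (Icc 0 1) (Ioo A B) := by
    intro x hx
    have := (convex_Ioo A B).add_smul_sub_mem hs ht hx
    simpa [hℓ] using this
  have hsub : openAnnulus a ⊆ annulus a := openAnnulus_subset a
  set c : ℝ → ℂ := fun x => Complex.exp (γ (ℓ x)) with hc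
  have hcs : ContDiffOn ℝ ∞ c (Icc 0 1) := by
    have h1 : ContDiffOn ℝ ∞ (γ ∘ ℓ) (Icc 0 1) :=
      hγ.comp (by rw [hℓ]; fun_prop) hℓI
    exact (Complex.contDiff_exp (𝕜 := ℝ)).comp_contDiffOn h1
  have hmem : c ∈ curvesBetween a p q := by
    refine ⟨⟨hcs.continuousOn, 1, fun i => (i : ℕ), ?_, by simp, by simp, ?_⟩, ?_, ?_, ?_⟩
    · intro i j hij
      simpa using hij
    · intro i
      fin_cases i
      simpa using hcs
    · exact fun x hx => hsub ((exp_mem_openAnnulus_iff ha).2 (hγS (hℓI hx)))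
    · simp [hc, hℓ, hp]
    · simp [hc, hℓ, hq]
  refine (iInf₂_le c hmem).trans ?_
  rw [length_eq]
  have hspeed : ∀ x ∈ Icc (0 : ℝ) 1,
      Real.exp (u (c x)) * ‖deriv c x‖ = ‖w‖ * |t - s| := by
    intro x hx
    have hτ := hℓI hx
    have hγd : HasDerivAt γ (deriv γ (ℓ x)) (ℓ x) :=
      ((hγ.contDiffAt (Ioo_mem_nhds hτ.1 hτ.2)).differentiableAt (by simp)).hasDerivAt
    have hℓd : HasDerivAt ℓ (t - s) x := by
      simpa [hℓ] using ((hasDerivAt_id' x).mul_const (t - s)).const_add s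
    have h3 : F' (γ (ℓ x)) * deriv γ (ℓ x) = w :=
      mul_deriv_eq_of_lift (hF _ (hγS hτ)) hγd.differentiableAt
        (by filter_upwards [Ioo_mem_nhds hτ.1 hτ.2] with τ hτ using hline τ hτ)
    have h4 : HasDerivAt c (Complex.exp (γ (ℓ x)) * ((t - s) • deriv γ (ℓ x))) x :=
      (hγd.scomp x hℓd).cexp
    rw [h4.deriv, norm_mul, norm_smul, Real.norm_eq_abs, ← h3, norm_mul, hF' _ (hγS hτ)]
    ring
  rw [setLIntegral_congr_fun measurableSet_Icc (fun x hx => by rw [hspeed x hx])]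
  simp

/-! ### Lifting segments through a local homeomorphism -/

/-- A path lifts through a local homeomorphism if every partial lift has a limit at its end. -/
lemma exists_path_lift {E X : Type*} [TopologicalSpace E] [T2Space E] [TopologicalSpace X]
    {p : E → X} (hp : IsLocalHomeomorph p) {σ : ℝ → X} (hσ : Continuous σ) {e₀ : E}
    (he₀ : p e₀ = σ 0)
    (hlim : ∀ S ∈ Ioc (0 : ℝ) 1, ∀ γ : ℝ → E, ContinuousOn γ (Ico 0 S) → γ 0 = e₀ →
      (∀ τ ∈ Ico 0 S, p (γ τ) = σ τ) → ∃ l, Tendsto γ (𝓝[<] S) (𝓝 l) ∧ p l = σ S) :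
    ∃ γ : ℝ → E, ContinuousOn γ (Icc 0 1) ∧ γ 0 = e₀ ∧ ∀ τ ∈ Icc (0 : ℝ) 1, p (γ τ) = σ τ := by
  set P : ℝ → (ℝ → E) → Prop := fun s γ =>
    ContinuousOn γ (Icc 0 s) ∧ γ 0 = e₀ ∧ ∀ τ ∈ Icc 0 s, p (γ τ) = σ τ with hP
  set A : Set ℝ := {s | s ∈ Icc (0 : ℝ) 1 ∧ ∃ γ, P s γ} with hA
  have hmono : ∀ {s s' γ}, s ≤ s' → P s' γ → P s γ := fun h hγ =>
    ⟨hγ.1.mono (Icc_subset_Icc_right h), hγ.2.1, fun τ hτ => hγ.2.2 τ ⟨hτ.1, hτ.2.trans h⟩⟩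
  have huniq : ∀ {s γ γ'}, P s γ → P s γ' → EqOn γ γ' (Icc 0 s) := by
    intro s γ γ' h h'
    rcases lt_or_ge s 0 with hs | hs
    · simp [Icc_eq_empty (not_le.2 hs)]
    exact (T2Space.isSeparatedMap p).eqOn_of_comp_eqOn hp.isLocallyInjective isPreconnected_Icc
      h.1 h'.1 (fun τ hτ => (h.2.2 τ hτ).trans (h'.2.2 τ hτ).symm) (left_mem_Icc.2 hs)
      (h.2.1.trans h'.2.1.symm)
  have h0A : (0 : ℝ) ∈ A := ⟨by simp, fun _ => e₀, continuousOn_const, rfl, fun τ hτ => by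
    rw [Icc_self, mem_singleton_iff] at hτ
    rw [hτ, he₀]⟩
  have hbdd : BddAbove A := ⟨1, fun s hs => hs.1.2⟩
  set S := sSup A with hS
  have hS0 : 0 ≤ S := le_csSup hbdd h0A
  have hS1 : S ≤ 1 := csSup_le ⟨0, h0A⟩ fun s hs => hs.1.2
  have hlt : ∀ s ∈ Ico 0 S, ∃ γ, P s γ := by
    intro s hs
    obtain ⟨s', hs', hss'⟩ := exists_lt_of_lt_csSup ⟨0, h0A⟩ hs.2
    obtain ⟨γ, hγ⟩ := hs'.2
    exact ⟨γ, hmono hss'.le hγ⟩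
  obtain ⟨γ, hγ⟩ : ∃ γ, P S γ := by
    rcases hS0.eq_or_lt with h | h
    · rw [← h]; exact h0A.2
    have : Nonempty E := ⟨e₀⟩
    choose! Γ hΓ using hlt
    -- Lifts on shorter intervals agree by uniqueness, so the diagonal glues them into one lift on
    -- `[0, S)`.
    set γ : ℝ → E := fun τ => Γ τ τ with hγdef
    have hagree : ∀ s ∈ Ico 0 S, EqOn γ (Γ s) (Icc 0 s) := fun s hs τ hτ =>
      huniq (hΓ τ ⟨hτ.1, hτ.2.trans_lt hs.2⟩) (hmono hτ.2 (hΓ s hs)) ⟨hτ.1, le_rfl⟩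
    have hcont : ContinuousOn γ (Ico 0 S) := by
      intro τ hτ
      obtain ⟨s, hs1, hs2⟩ := exists_between hτ.2
      have hs : s ∈ Ico 0 S := ⟨hτ.1.trans hs1.le, hs2⟩
      have h1 : ContinuousWithinAt γ (Icc 0 s) τ :=
        ((hΓ s hs).1.congr (hagree s hs)) τ ⟨hτ.1, hs1.le⟩
      refine h1.mono_of_mem_nhdsWithin ?_
      filter_upwards [self_mem_nhdsWithin, mem_nhdsWithin_of_mem_nhds (Iio_mem_nhds hs1)]
        with x hx hx'
      exact ⟨hx.1, (mem_Iio.1 hx').le⟩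
    have hγ0 : γ 0 = e₀ := (hΓ 0 ⟨le_rfl, h⟩).2.1
    have hlift : ∀ τ ∈ Ico 0 S, p (γ τ) = σ τ := fun τ hτ => (hΓ τ hτ).2.2 τ ⟨hτ.1, le_rfl⟩
    obtain ⟨l, hl, hpl⟩ := hlim S ⟨h, hS1⟩ γ hcont hγ0 hlift
    classical
    refine ⟨Function.update γ S l, ?_, ?_, ?_⟩
    · rw [continuousOn_update_iff, Icc_sdiff_right]
      refine ⟨hcont, fun _ => hl.mono_left (nhdsWithin_mono _ fun x hx => hx.2)⟩
    · rw [Function.update_of_ne h.ne, hγ0]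
    · intro τ hτ
      rcases hτ.2.eq_or_lt with rfl | hτS
      · simpa using hpl
      · rw [Function.update_of_ne hτS.ne]
        exact hlift τ ⟨hτ.1, hτS⟩
  rcases hS1.eq_or_lt with h | h
  · rw [h] at hγ
    exact ⟨γ, hγ⟩
  exfalso
  -- If `S < 1`, a local inverse of `p` at `γ S` prolongs the lift beyond the supremum.
  obtain ⟨e, hes, hpe⟩ := hp (γ S)
  have hSS : S ∈ Icc 0 S := ⟨hS0, le_rfl⟩
  have het : σ S ∈ e.target := by
    rw [← hγ.2.2 S hSS, hpe]
    exact e.map_source hes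
  obtain ⟨ε, hε, hball⟩ := Metric.mem_nhds_iff.1
    (hσ.continuousAt.preimage_mem_nhds (e.open_target.mem_nhds het))
  set s' := min 1 (S + ε / 2) with hs'
  have hSs' : S < s' := lt_min h (by linarith)
  have htarget : ∀ τ ∈ Icc S s', σ τ ∈ e.target := by
    intro τ hτ
    refine hball ?_
    rw [Metric.mem_ball, Real.dist_eq, abs_of_nonneg (by linarith [hτ.1])]
    have := hτ.2.trans (min_le_right _ _)
    linarith
  have hsymm : e.symm (σ S) = γ S := by
    rw [← hγ.2.2 S hSS, hpe]
    exact e.left_inv hes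
  refine absurd (le_csSup hbdd (a := s') ⟨⟨hS0.trans hSs'.le, min_le_left _ _⟩,
    fun τ => if τ ≤ S then γ τ else e.symm (σ τ), ?_, ?_, ?_⟩) (not_le.2 hSs')
  · have hfun1 : EqOn (fun τ => if τ ≤ S then γ τ else e.symm (σ τ)) γ (Icc 0 S) :=
      fun τ hτ => if_pos hτ.2
    have hfun2 : EqOn (fun τ => if τ ≤ S then γ τ else e.symm (σ τ)) (fun τ => e.symm (σ τ))
        (Icc S s') := by
      intro τ hτ
      rcases hτ.1.eq_or_lt with rfl | h'
      · simp [hsymm]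
      · exact if_neg (not_le.2 h')
    rw [← Icc_union_Icc_eq_Icc hS0 hSs'.le]
    refine ContinuousOn.union_of_isClosed (hγ.1.congr hfun1) (ContinuousOn.congr ?_ hfun2)
      isClosed_Icc isClosed_Icc
    exact e.symm.continuousOn.comp hσ.continuousOn htarget
  · simp only [hS0, if_true, hγ.2.1]
  · intro τ hτ
    by_cases hτS : τ ≤ S
    · simp only [hτS, if_true]
      exact hγ.2.2 τ ⟨hτ.1, hτS⟩
    · simp only [hτS, if_false]
      rw [hpe]
      exact e.right_inv (htarget τ ⟨(not_le.1 hτS).le, hτ.2⟩)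

/-- A local homeomorphism through which all segments issuing from `p e₀` of length less than `R`
lift has a continuous section on the ball of radius `R`. -/
lemma exists_section_of_segment_lift {E : Type*} [TopologicalSpace E] [T2Space E]
    {p : E → ℂ} (hp : IsLocalHomeomorph p) {e₀ : E} {R : ℝ} (hR : 0 < R)
    (hlift : ∀ w ∈ Metric.ball (0 : ℂ) R, ∃ γ : ℝ → E, ContinuousOn γ (Icc 0 1) ∧ γ 0 = e₀ ∧
      ∀ τ ∈ Icc (0 : ℝ) 1, p (γ τ) = p e₀ + τ • w) :
    ∃ G : ℂ → E, ContinuousOn G (Metric.ball 0 R) ∧ G 0 = e₀ ∧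
      ∀ w ∈ Metric.ball (0 : ℂ) R, p (G w) = p e₀ + w := by
  have : Nonempty E := ⟨e₀⟩
  choose! Γ hΓ using hlift
  have hcont : ContinuousOn (fun w => Γ w 1) (Metric.ball 0 R) := by
    rw [continuousOn_iff_continuous_domRestrict]
    -- The segments form a homotopy parametrized by `w`; joint continuity of its lift makes the end
    -- point `Γ w 1` continuous in `w`.
    have := hp.continuous_lift (T2Space.isSeparatedMap p) (A := Metric.ball (0 : ℂ) R)
      (g := fun x => Γ x.2 x.1)
      ⟨fun x => p e₀ + (x.1 : ℝ) • (x.2 : ℂ), by fun_prop⟩ ?_ ?_ ?_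
    · exact this.comp (by fun_prop : Continuous fun w : Metric.ball (0 : ℂ) R => ((1 : unitInterval), w))
    · ext x
      exact (hΓ x.2 x.2.2).2.2 x.1 x.1.2
    · exact continuous_const.congr fun w : Metric.ball (0 : ℂ) R => ((hΓ w w.2).2.1).symm
    · intro w
      exact (continuousOn_iff_continuous_domRestrict.1 (hΓ w w.2).1)
  have h0 : (0 : ℂ) ∈ Metric.ball (0 : ℂ) R := Metric.mem_ball_self hR
  refine ⟨fun w => Γ w 1, hcont, ?_, fun w hw => ?_⟩
  · have h1 := (T2Space.isSeparatedMap p).constOn_of_comp hp.isLocallyInjective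
      isPreconnected_Icc (hΓ 0 h0).1 (fun a ha b hb => by
        rw [(hΓ 0 h0).2.2 a ha, (hΓ 0 h0).2.2 b hb, smul_zero, smul_zero])
      (right_mem_Icc.2 zero_le_one) (left_mem_Icc.2 zero_le_one)
    exact h1.trans (hΓ 0 h0).2.1
  · have := (hΓ w hw).2.2 1 (right_mem_Icc.2 zero_le_one)
    rwa [one_smul] at this

/-- A holomorphic function on an open set without critical points restricts to a local
homeomorphism. -/
lemma isLocalHomeomorph_restrict {F F' : ℂ → ℂ} {s : Set ℂ} (hs : IsOpen s)
    (hF : ∀ ζ ∈ s, HasDerivAt F (F' ζ) ζ) (hF' : ∀ ζ ∈ s, F' ζ ≠ 0) :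
    IsLocalHomeomorph fun ζ : s => F ζ := by
  have h1 : IsLocalHomeomorphOn F s := by
    intro ζ hζ
    have h2 : AnalyticAt ℂ F ζ := DifferentiableOn.analyticAt
      (fun z hz => (hF z hz).differentiableAt.differentiableWithinAt) (hs.mem_nhds hζ)
    have h3 : HasStrictDerivAt F (F' ζ) ζ := by
      have := h2.hasStrictDerivAt
      rwa [(hF ζ hζ).deriv] at this
    have h4 := h3.hasStrictFDerivAt_equiv (hF' ζ hζ)
    exact ⟨h4.toOpenPartialHomeomorph F, h4.mem_toOpenPartialHomeomorph_source, rfl⟩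
  rw [isLocalHomeomorph_iff_isLocalHomeomorphOn_univ]
  exact h1.comp hs.isOpenEmbedding_subtypeVal.isLocalHomeomorph.isLocalHomeomorphOn
    fun ζ _ => ζ.2

/-! ### The minimum principle against blow-up at the inner circle -/

/-- A function harmonic on the annulus and continuous up to the outer circle does not tend to
`+∞` at the inner circle. -/
lemma not_tendsto_atTop_inner {a : ℝ} (ha0 : 0 < a) (ha1 : a < 1) {u : ℂ → ℝ}
    (hu : ContinuousOn u (annulus a)) {H : ℂ → ℂ} (hH : DifferentiableOn ℂ H (strip a))
    (hHu : ∀ ζ ∈ strip a, (H ζ).re = u (Complex.exp ζ))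
    (htop : ∀ K : ℝ, ∃ ρ > a, ∀ z : ℂ, a < ‖z‖ → ‖z‖ < ρ → K ≤ u z) : False := by
  have hcirc : Metric.sphere (0 : ℂ) 1 ⊆ annulus a := fun z hz => by
    rw [mem_sphere_zero_iff_norm] at hz
    exact ⟨by rw [hz]; exact ha1, hz.le⟩
  obtain ⟨z₀, -, hz₀⟩ := (isCompact_sphere (0 : ℂ) 1).exists_isMinOn ⟨1, by simp⟩ (hu.mono hcirc)
  have hmin : ∀ N : ℝ, 0 ≤ N → ∀ z ∈ annulus a, u z₀ ≤ u z + N * Real.log ‖z‖ := by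
    intro N hN z₁ hz₁
    by_contra! hcon
    set φ : ℂ → ℝ := fun z => u z + N * Real.log ‖z‖ with hφ
    have hφcont : ContinuousOn φ (annulus a) :=
      hu.add (continuousOn_const.mul (continuous_norm.continuousOn.log
        fun z hz => (ha0.trans hz.1).ne'))
    obtain ⟨ρ, hρ, hbig⟩ := htop (φ z₁ + 1 - N * Real.log a)
    have hbig' : ∀ z : ℂ, a < ‖z‖ → ‖z‖ < ρ → φ z₁ + 1 ≤ φ z := by
      intro z hz hzρ
      have h1 := hbig z hz hzρ
      have h2 := mul_le_mul_of_nonneg_left (Real.log_le_log ha0 hz.le) hN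
      simp only [hφ] at h1 ⊢
      linarith
    have hz₁ρ : ρ ≤ ‖z₁‖ := by
      by_contra! h
      linarith [hbig' z₁ hz₁.1 h]
    -- Near the inner circle `φ ≥ φ z₁ + 1`, so the infimum of `φ` is attained on this compact set.
    set K : Set ℂ := {z | ρ ≤ ‖z‖} ∩ Metric.closedBall 0 1 with hK
    have hKc : IsCompact K :=
      (isCompact_closedBall (0 : ℂ) 1).inter_left (isClosed_le continuous_const continuous_norm)
    have hKa : K ⊆ annulus a := fun z hz =>
      ⟨hρ.trans_le hz.1, mem_closedBall_zero_iff.1 hz.2⟩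
    have hz₁K : z₁ ∈ K := ⟨hz₁ρ, mem_closedBall_zero_iff.2 hz₁.2⟩
    obtain ⟨z₂, hz₂K, hz₂⟩ := hKc.exists_isMinOn ⟨z₁, hz₁K⟩ (hφcont.mono hKa)
    have h21 : φ z₂ ≤ φ z₁ := hz₂ hz₁K
    have hglob : ∀ z ∈ annulus a, φ z₂ ≤ φ z := by
      intro z hz
      rcases lt_or_ge ‖z‖ ρ with h | h
      · linarith [hbig' z hz.1 h]
      · exact hz₂ (show z ∈ K from ⟨h, mem_closedBall_zero_iff.2 hz.2⟩)
    -- On the unit circle the logarithm vanishes, so there `φ = u ≥ u z₀ > φ z₁`.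
    have hz₂lt : ‖z₂‖ < 1 := by
      refine lt_of_le_of_ne (hKa hz₂K).2 fun h => ?_
      have h1 : u z₀ ≤ u z₂ := hz₀ (show z₂ ∈ Metric.sphere (0 : ℂ) 1 by simpa using h)
      have h2 : φ z₂ = u z₂ := by simp [hφ, h]
      linarith
    have hz₂0 : z₂ ≠ 0 := norm_pos_iff.1 (ha0.trans (hKa hz₂K).1)
    have hlog : Complex.log z₂ ∈ strip a := by
      rw [← exp_mem_openAnnulus_iff ha0, Complex.exp_log hz₂0]
      exact ⟨(hKa hz₂K).1, hz₂lt⟩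
    -- Since `|f| = e^{-φ ∘ exp}`, the minimum of `φ` becomes a maximum of `|f|` on the strip, and
    -- the maximum modulus principle forces `φ` to be constant.
    set f : ℂ → ℂ := fun ζ => Complex.exp (-(H ζ + N * ζ)) with hf
    have hfd : DifferentiableOn ℂ f (strip a) :=
      ((hH.add (differentiableOn_id.const_mul _)).neg).cexp
    have hfn : ∀ ζ ∈ strip a, ‖f ζ‖ = Real.exp (-φ (Complex.exp ζ)) := by
      intro ζ hζ
      simp [hf, hφ, Complex.norm_exp, hHu ζ hζ]
    have hmax : IsMaxOn (norm ∘ f) (strip a) (Complex.log z₂) := by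
      intro ζ hζ
      simp only [Function.comp_apply, mem_ofPred_eq]
      rw [hfn ζ hζ, hfn _ hlog, Complex.exp_log hz₂0, Real.exp_le_exp, neg_le_neg_iff]
      exact hglob _ (openAnnulus_subset a ((exp_mem_openAnnulus_iff ha0).2 hζ))
    obtain ⟨r, hr1, hr2⟩ := exists_between (lt_min hρ ha1)
    have hr0 : 0 < r := ha0.trans hr1
    have hrρ := hr2.trans_le (min_le_left _ _)
    have hrS : ((Real.log r : ℝ) : ℂ) ∈ strip a := by
      rw [← exp_mem_openAnnulus_iff ha0, ← Complex.ofReal_exp, Real.exp_log hr0]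
      simp only [openAnnulus, mem_ofPred_eq, Complex.norm_real, Real.norm_of_nonneg hr0.le]
      exact ⟨hr1, hr2.trans_le (min_le_right _ _)⟩
    have hconst : ‖f (Real.log r : ℝ)‖ = ‖f (Complex.log z₂)‖ :=
      Complex.norm_eqOn_of_isPreconnected_of_isMaxOn (convex_strip a).isPreconnected
        (isOpen_strip a) hfd hlog hmax hrS
    rw [hfn _ hrS, hfn _ hlog, Complex.exp_log hz₂0, Real.exp_eq_exp, neg_inj,
      ← Complex.ofReal_exp, Real.exp_log hr0] at hconst
    have := hbig' (r : ℂ) (by simpa [abs_of_pos hr0] using hr1)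
      (by simpa [abs_of_pos hr0] using hrρ)
    linarith
  obtain ⟨r, hr1, hr2⟩ := exists_between ha1
  have hr0 : 0 < r := ha0.trans hr1
  have hrn : ‖(r : ℂ)‖ = r := by simp [abs_of_pos hr0]
  have hlog : Real.log r < 0 := Real.log_neg hr0 hr2
  -- This `N` gives `N log r = -(|u z₀ - u r| + 1)`, too negative for `hmin`.
  have h1 := hmin ((|u z₀ - u r| + 1) / -Real.log r)
    (div_nonneg (by positivity) (by linarith)) r ⟨by rwa [hrn], by rw [hrn]; exact hr2.le⟩
  rw [hrn, div_mul_eq_mul_div, div_neg, mul_div_cancel_right₀ _ hlog.ne] at h1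
  linarith [neg_abs_le (u z₀ - u r)]

/-! ### Completeness prevents lifts from escaping -/

/-- Near `τ` a continuous lift is a holomorphic local inverse of `F` composed with an affine map.
This smoothness makes the projected lift an admissible curve for the Riemannian distance. -/
lemma contDiffAt_of_lift {F F' : ℂ → ℂ} {s : Set ℂ} (hs : IsOpen s)
    (hF : ∀ ζ ∈ s, HasDerivAt F (F' ζ) ζ) (hF' : ∀ ζ ∈ s, F' ζ ≠ 0) {γ : ℝ → ℂ} {τ : ℝ} {z w : ℂ}
    (hγ : ContinuousAt γ τ) (hτ : γ τ ∈ s) (hline : ∀ᶠ x in 𝓝 τ, F (γ x) = z + x • w) :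
    ContDiffAt ℝ ∞ γ τ := by
  have h2 : AnalyticAt ℂ F (γ τ) := DifferentiableOn.analyticAt
    (fun z hz => (hF z hz).differentiableAt.differentiableWithinAt) (hs.mem_nhds hτ)
  have h3 : HasStrictDerivAt F (F' (γ τ)) (γ τ) := by
    have := h2.hasStrictDerivAt
    rwa [(hF _ hτ).deriv] at this
  have h4 := h3.hasStrictFDerivAt_equiv (hF' _ hτ)
  set e := h4.toOpenPartialHomeomorph F with he
  have heF : ∀ ζ, e ζ = F ζ := fun ζ => rfl
  have hes : γ τ ∈ e.source := h4.mem_toOpenPartialHomeomorph_source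
  have hsymm : e.symm (F (γ τ)) = γ τ := e.left_inv hes
  have h5 : ContDiffAt ℂ ∞ e.symm (F (γ τ)) :=
    e.contDiffAt_symm_deriv (hF' _ hτ) (e.map_source hes) (by rw [hsymm]; exact hF _ hτ)
      (by rw [hsymm]; exact h2.contDiffAt)
  rw [hline.self_of_nhds] at h5
  have h6 : ContDiffAt ℝ ∞ (fun x : ℝ => e.symm (z + x • w)) τ :=
    (h5.restrict_scalars ℝ).comp τ (f := fun x : ℝ => z + x • w) (by fun_prop)
  refine h6.congr_of_eventuallyEq ?_
  filter_upwards [hline, hγ.preimage_mem_nhds (e.open_source.mem_nhds hes)] with x hx hx'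
  rw [← hx]
  exact (e.left_inv hx').symm

/-- On a complete annulus, the lift to the strip of a segment of length `‖w‖ < e^m (1 - ρ)`
through the developing map `F` does not escape, if it starts over `{‖z‖ < ρ}` and `u ≥ m` on
`{ρ ≤ ‖z‖}`. -/
lemma exists_tendsto_of_lift {a ρ m : ℝ} (ha0 : 0 < a) {u : ℂ → ℝ}
    (hu : ContinuousOn u (annulus a)) (hm : ∀ z ∈ annulus a, ρ ≤ ‖z‖ → m ≤ u z)
    (hcomplete : IsCompleteMetric a u) {F F' : ℂ → ℂ}
    (hF : ∀ ζ ∈ strip a, HasDerivAt F (F' ζ) ζ)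
    (hF' : ∀ ζ ∈ strip a, ‖F' ζ‖ = Real.exp (u (Complex.exp ζ)) * ‖Complex.exp ζ‖)
    {γ : ℝ → ℂ} {S : ℝ} (hS : 0 < S) (hS1 : S ≤ 1) (hγ : ContinuousOn γ (Ico 0 S))
    (hγS : MapsTo γ (Ico 0 S) (strip a)) (h0 : ‖Complex.exp (γ 0)‖ < ρ) {z w : ℂ}
    (hw : ‖w‖ < Real.exp m * (1 - ρ)) (hline : ∀ τ ∈ Ico 0 S, F (γ τ) = z + τ • w) :
    ∃ l ∈ strip a, Tendsto γ (𝓝[<] S) (𝓝 l) := by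
  have hF'0 : ∀ ζ ∈ strip a, F' ζ ≠ 0 := fun ζ hζ => norm_pos_iff.1 (by
    rw [hF' ζ hζ]
    exact mul_pos (Real.exp_pos _) (norm_pos_iff.2 (Complex.exp_ne_zero _)))
  have hIoo : Ioo 0 S ⊆ Ico 0 S := Ioo_subset_Ico_self
  have hlineat : ∀ τ ∈ Ioo 0 S, ∀ᶠ x in 𝓝 τ, F (γ x) = z + x • w := fun τ hτ => by
    filter_upwards [Ioo_mem_nhds hτ.1 hτ.2] with x hx using hline x (hIoo hx)
  have hsm : ContDiffOn ℝ ∞ γ (Ioo 0 S) := fun τ hτ =>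
    (contDiffAt_of_lift (isOpen_strip a) hF hF'0 (hγ.continuousAt (Ico_mem_nhds hτ.1 hτ.2))
      (hγS (hIoo hτ)) (hlineat τ hτ)).contDiffWithinAt
  have hmem : ∀ τ ∈ Ioo 0 S, Complex.exp (γ τ) ∈ annulus a := fun τ hτ =>
    openAnnulus_subset a ((exp_mem_openAnnulus_iff ha0).2 (hγS (hIoo hτ)))
  have hdist : ∀ s (hs : s ∈ Ioo 0 S) t (ht : t ∈ Ioo 0 S),
      riemDist a u ⟨_, hmem s hs⟩ ⟨_, hmem t ht⟩ ≤ ENNReal.ofReal (‖w‖ * |t - s|) :=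
    fun s hs t ht => riemDist_exp_le ha0 hF hF' hsm (hγS.mono_left hIoo)
      (fun τ hτ => hline τ (hIoo hτ)) hs ht rfl rfl
  obtain ⟨t, -, ht, htS⟩ := exists_seq_strictMono_tendsto' hS
  set x : ℕ → annulus a := fun n => ⟨_, hmem (t n) (ht n)⟩ with hx
  obtain ⟨q, hq⟩ := hcomplete x (by
    intro ε hε
    have h1 := cauchySeq_iff_tendsto_dist_atTop_0.1 htS.cauchySeq
    have h2 : Tendsto (fun n : ℕ × ℕ => ENNReal.ofReal (‖w‖ * dist (t n.1) (t n.2))) atTop (𝓝 0) := by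
      simpa using ENNReal.tendsto_ofReal (h1.const_mul ‖w‖)
    obtain ⟨N, hN⟩ := eventually_atTop_prod_self.1 (h2.eventually_lt_const hε)
    refine ⟨N, fun i hi j hj => (hdist _ (ht i) _ (ht j)).trans_lt ?_⟩
    rw [← Real.dist_eq]
    exact hN j i hj hi)
  have hxq := tendsto_of_tendsto_riemDist hu hq
  -- the limit is not on the unit circle
  have hq1 : ‖(q : ℂ)‖ < 1 := by
    -- `hdist` covers only the open interval, so the starting time `0` is replaced by a slightly
    -- later one.
    obtain ⟨τ₀, hτ₀, hτ₀ρ⟩ : ∃ τ₀ ∈ Ioo 0 S, ‖Complex.exp (γ τ₀)‖ < ρ := by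
      have h1 : ContinuousWithinAt (fun τ => ‖Complex.exp (γ τ)‖) (Ioo 0 S) 0 :=
        (((hγ 0 ⟨le_rfl, hS⟩).mono hIoo).cexp).norm
      have h2 : (𝓝[Ioo 0 S] (0 : ℝ)).NeBot := by
        rw [nhdsWithin_Ioo_eq_nhdsGT hS]
        infer_instance
      exact ((eventually_mem_nhdsWithin).and (h1.eventually_lt_const h0)).exists
    have hbound : ∀ n, ‖(x n : ℂ)‖ ≤ ρ + ‖w‖ / Real.exp m := by
      intro n
      have h1 := (le_riemDist_of_crossing (a := a) (u := u) (lipschitzWith_one_norm (E := ℂ))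
        (α := ρ) (β := ‖(x n : ℂ)‖) (m := m) (fun z hz h _ => hm z hz h)
        (p := ⟨_, hmem τ₀ hτ₀⟩) (q := x n) hτ₀ρ.le le_rfl).trans (hdist τ₀ hτ₀ (t n) (ht n))
      rw [ENNReal.ofReal_le_ofReal_iff (by positivity)] at h1
      have h2 : |t n - τ₀| ≤ 1 := by
        rw [abs_le]
        constructor <;> linarith [(ht n).1, (ht n).2, hτ₀.1, hτ₀.2]
      have h3 := h1.trans (mul_le_of_le_one_right (norm_nonneg w) h2)
      rw [← sub_le_iff_le_add', le_div_iff₀ (Real.exp_pos m)]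
      linarith
    have h1 : ‖(q : ℂ)‖ ≤ ρ + ‖w‖ / Real.exp m :=
      le_of_tendsto hxq.norm (Eventually.of_forall hbound)
    have h2 : ‖w‖ / Real.exp m < 1 - ρ := by
      rw [div_lt_iff₀ (Real.exp_pos m)]
      linarith
    linarith
  -- the lift stays close to the limit, hence is Lipschitz near the end
  obtain ⟨δ, hδ, hu'⟩ := Metric.continuousWithinAt_iff.1 (hu q q.2) 1 one_pos
  set M := u q - 1 with hM
  have hnear : ∀ z ∈ annulus a, dist z (q : ℂ) ≤ δ / 2 → M ≤ u z := by
    intro z hz h1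
    have h2 := hu' hz (by linarith)
    rw [Real.dist_eq, abs_lt] at h2
    linarith
  obtain ⟨n, hn1, hn2⟩ : ∃ n, dist (x n : ℂ) q ≤ δ / 4 ∧
      ‖w‖ * (S - t n) < Real.exp M * (δ / 2 - δ / 4) := by
    have h1 : Tendsto (fun n => ‖w‖ * (S - t n)) atTop (𝓝 0) := by
      simpa using (htS.const_sub S).const_mul ‖w‖
    have h2 : Tendsto (fun n => dist (x n : ℂ) q) atTop (𝓝 0) := tendsto_iff_dist_tendsto_zero.1 hxq
    exact ((h2.eventually_le_const (by positivity)).and (h1.eventually_lt_const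
      (mul_pos (Real.exp_pos _) (by linarith)))).exists
  have hIoo' : Ioo (t n) S ⊆ Ioo 0 S := Ioo_subset_Ioo_left (ht n).1.le
  have hclose : ∀ τ ∈ Ioo (t n) S, dist (Complex.exp (γ τ)) q ≤ δ / 2 := by
    intro τ hτ
    by_contra! hcon
    have h1 := (le_riemDist_of_crossing (a := a) (u := u) (LipschitzWith.dist_left (q : ℂ))
      (α := δ / 4) (β := δ / 2) (m := M) (fun z hz _ h => hnear z hz h)
      (p := x n) (q := ⟨_, hmem τ (hIoo' hτ)⟩) hn1 hcon.le).trans (hdist _ (ht n) τ (hIoo' hτ))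
    rw [ENNReal.ofReal_le_ofReal_iff (by positivity), abs_of_pos (by linarith [hτ.1])] at h1
    have h2 := mul_le_mul_of_nonneg_left (sub_le_sub_right hτ.2.le (t n)) (norm_nonneg w)
    linarith
  -- From `F' γ' = w` and `|F'| = e^u |exp| ≥ e^M a` near `q`.
  have hlip : LipschitzOnWith (Real.toNNReal (‖w‖ / (Real.exp M * a))) γ (Ioo (t n) S) := by
    refine (convex_Ioo (t n) S).lipschitzOnWith_of_nnnorm_deriv_le (𝕜 := ℝ) (fun τ hτ => ?_)
      fun τ hτ => ?_
    · exact ((hsm.contDiffAt (Ioo_mem_nhds (hIoo' hτ).1 (hIoo' hτ).2))).differentiableAt (by simp)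
    · have h1 := mul_deriv_eq_of_lift (hF _ (hγS (hIoo (hIoo' hτ))))
        (((hsm.contDiffAt (Ioo_mem_nhds (hIoo' hτ).1 (hIoo' hτ).2))).differentiableAt (by simp))
        (hlineat τ (hIoo' hτ))
      have h2 := congrArg norm h1
      rw [norm_mul, hF' _ (hγS (hIoo (hIoo' hτ)))] at h2
      rw [← NNReal.coe_le_coe, coe_nnnorm, Real.coe_toNNReal _ (by positivity),
        le_div_iff₀ (by positivity), ← h2, mul_comm]
      have h3 := hmem τ (hIoo' hτ)
      have h4 := Real.exp_le_exp.2 (hnear _ h3 (hclose τ hτ))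
      exact mul_le_mul_of_nonneg_right
        (mul_le_mul h4 h3.1.le ha0.le (Real.exp_pos _).le) (norm_nonneg _)
  -- Convergence of `exp ∘ γ` alone would leave the branch of the logarithm open; the Lipschitz
  -- extension gives a limit of `γ` itself.
  obtain ⟨g, hg, hgγ⟩ := hlip.extend_finite_dimension
  have hlim : Tendsto γ (𝓝[<] S) (𝓝 (g S)) := by
    refine (hg.continuous.continuousAt.mono_left nhdsWithin_le_nhds).congr' ?_
    filter_upwards [Ioo_mem_nhdsLT (ht n).2] with τ hτ using (hgγ hτ).symm
  have hexp : Complex.exp (g S) = q := by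
    refine tendsto_nhds_unique ?_ hxq
    exact (Complex.continuous_exp.continuousAt.tendsto.comp hlim).comp
      (tendsto_nhdsWithin_iff.2 ⟨htS, Eventually.of_forall fun k => (ht k).2⟩)
  refine ⟨g S, ?_, hlim⟩
  rw [← exp_mem_openAnnulus_iff ha0, hexp]
  exact ⟨q.2.1, hq1⟩

/-! ### Blow-up of the conformal factor and conclusion -/

/-- On a complete annulus the conformal factor is bounded below by the reciprocal of the
logarithmic distance to the inner circle. -/
lemma le_norm_deriv_of_isCompleteMetric {a ρ m : ℝ} (ha0 : 0 < a) (hρ : ρ < 1) {u : ℂ → ℝ}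
    (hu : ContinuousOn u (annulus a)) (hm : ∀ z ∈ annulus a, ρ ≤ ‖z‖ → m ≤ u z)
    (hcomplete : IsCompleteMetric a u) {F F' : ℂ → ℂ}
    (hF : ∀ ζ ∈ strip a, HasDerivAt F (F' ζ) ζ)
    (hF' : ∀ ζ ∈ strip a, ‖F' ζ‖ = Real.exp (u (Complex.exp ζ)) * ‖Complex.exp ζ‖)
    {ζ₀ : ℂ} (hζ₀ : ζ₀ ∈ strip a) (hζ₀ρ : ‖Complex.exp ζ₀‖ < ρ) :
    Real.exp m * (1 - ρ) ≤ 2 * (ζ₀.re - Real.log a) * ‖F' ζ₀‖ := by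
  set R := Real.exp m * (1 - ρ) with hR
  have hR0 : 0 < R := mul_pos (Real.exp_pos _) (by linarith)
  have hF'0 : ∀ ζ ∈ strip a, F' ζ ≠ 0 := fun ζ hζ => norm_pos_iff.1 (by
    rw [hF' ζ hζ]
    exact mul_pos (Real.exp_pos _) (norm_pos_iff.2 (Complex.exp_ne_zero _)))
  have hloc := isLocalHomeomorph_restrict (isOpen_strip a) hF hF'0
  obtain ⟨G, hG, hG0, hGF⟩ := exists_section_of_segment_lift hloc (e₀ := ⟨ζ₀, hζ₀⟩) hR0 (by
    intro w hw
    rw [mem_ball_zero_iff] at hw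
    refine exists_path_lift hloc (σ := fun τ : ℝ => F ζ₀ + τ • w) (by fun_prop) (by simp) ?_
    intro S hS γ hγ hγ0 hline
    obtain ⟨l, hl, hlim⟩ := exists_tendsto_of_lift ha0 hu hm hcomplete hF hF'
      (γ := fun τ => (γ τ : ℂ)) hS.1 hS.2 (continuous_subtype_val.comp_continuousOn hγ)
      (fun τ _ => (γ τ).2) (by rw [hγ0]; exact hζ₀ρ) hw hline
    refine ⟨⟨l, hl⟩, tendsto_subtype_rng.2 hlim, ?_⟩
    refine tendsto_nhds_unique ((hF l hl).continuousAt.tendsto.comp hlim) ?_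
    have h1 : Tendsto (fun τ : ℝ => F ζ₀ + τ • w) (𝓝[<] S) (𝓝 (F ζ₀ + S • w)) :=
      (by fun_prop : Continuous fun τ : ℝ => F ζ₀ + τ • w).continuousAt.mono_left nhdsWithin_le_nhds
    refine h1.congr' ?_
    filter_upwards [Ioo_mem_nhdsLT hS.1] with τ hτ using (hline τ ⟨hτ.1.le, hτ.2⟩).symm)
  have hderiv : ∀ w ∈ Metric.ball (0 : ℂ) R,
      HasDerivAt (fun w => (G w : ℂ)) (F' (G w))⁻¹ w := by
    intro w hw
    refine HasDerivAt.of_local_left_inverse (f := fun ζ => F ζ - F ζ₀) ?_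
      ((hF _ (G w).2).sub_const _) (hF'0 _ (G w).2) ?_
    · exact (continuous_subtype_val.comp_continuousOn hG).continuousAt
        (Metric.isOpen_ball.mem_nhds hw)
    · filter_upwards [Metric.isOpen_ball.mem_nhds hw] with y hy
      rw [hGF y hy, add_sub_cancel_left]
  -- `G` takes values in the strip, hence in the half-plane `Re > log a`, and its derivative at `0`
  -- is `1 / F' ζ₀`.
  have h1 := norm_deriv_le_of_re_gt hR0
    (fun w hw => (hderiv w hw).differentiableAt.differentiableWithinAt)
    (fun w _ => (G w).2.1)
  have hpos : 0 < ‖F' ζ₀‖ := norm_pos_iff.2 (hF'0 _ hζ₀)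
  rw [(hderiv 0 (Metric.mem_ball_self hR0)).deriv, hG0, norm_inv, le_div_iff₀ hR0,
    inv_mul_le_iff₀ hpos] at h1
  linarith

/-- A flat conformal metric on the annulus is not complete, whatever its width. -/
theorem not_isCompleteMetric_of_isFlat {a : ℝ} (ha0 : 0 < a) (ha1 : a < 1) {u : ℂ → ℝ}
    (hu : ContinuousOn u (annulus a)) (hu2 : ContDiffOn ℝ 2 u (openAnnulus a))
    (hflat : IsFlat a u) : ¬ IsCompleteMetric a u := by
  intro hcomplete
  obtain ⟨H, hH, hHu⟩ := exists_holomorphic_re_eq ha0 fun z hz => harmonicAt_of_isFlat hu2 hflat hz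
  obtain ⟨F, hF⟩ := exists_primitive_of_convex (convex_strip a) (isOpen_strip a)
    (hH.add differentiableOn_id).cexp
  have hF' : ∀ ζ ∈ strip a, ‖Complex.exp ((H + id : ℂ → ℂ) ζ)‖
      = Real.exp (u (Complex.exp ζ)) * ‖Complex.exp ζ‖ := by
    intro ζ hζ
    rw [Pi.add_apply, Complex.exp_add, norm_mul, Complex.norm_exp (H ζ), hHu ζ hζ, id]
  obtain ⟨ρ, haρ, hρ1⟩ := exists_between ha1
  have hKa : {z : ℂ | ρ ≤ ‖z‖} ∩ Metric.closedBall 0 1 ⊆ annulus a := fun z hz =>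
    ⟨haρ.trans_le hz.1, mem_closedBall_zero_iff.1 hz.2⟩
  obtain ⟨m, hm⟩ := (((isCompact_closedBall (0 : ℂ) 1).inter_left
    (isClosed_le continuous_const continuous_norm)).image_of_continuousOn (hu.mono hKa)).bddBelow
  have hm' : ∀ z ∈ annulus a, ρ ≤ ‖z‖ → m ≤ u z := fun z hz h =>
    hm (mem_image_of_mem u ⟨h, mem_closedBall_zero_iff.2 hz.2⟩)
  refine not_tendsto_atTop_inner ha0 ha1 hu hH hHu fun K => ?_
  set R := Real.exp m * (1 - ρ) with hR
  have hR0 : 0 < R := mul_pos (Real.exp_pos _) (by linarith)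
  -- Chosen so that `R ≤ 2 d e^u`, valid at logarithmic distance less than `d` from the inner
  -- circle, says exactly `e^K ≤ e^u`.
  set d := R / (2 * Real.exp K) with hd
  have hd0 : 0 < d := by positivity
  refine ⟨min ρ (a * Real.exp d), lt_min haρ ?_, fun z hza hz => ?_⟩
  · exact lt_mul_of_one_lt_right ha0 (Real.one_lt_exp_iff.2 hd0)
  have hz0 : 0 < ‖z‖ := ha0.trans hza
  have hzρ : ‖z‖ < ρ := hz.trans_le (min_le_left _ _)
  have hexp : Complex.exp (Complex.log z) = z := Complex.exp_log (norm_pos_iff.1 hz0)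
  have hlog : Complex.log z ∈ strip a := by
    rw [← exp_mem_openAnnulus_iff ha0, hexp]
    exact ⟨hza, hzρ.trans hρ1⟩
  have h1 := le_norm_deriv_of_isCompleteMetric ha0 hρ1 hu hm' hcomplete hF hF' hlog
    (by rwa [hexp])
  rw [hF' _ hlog, hexp, Complex.log_re] at h1
  have h2 : Real.log ‖z‖ - Real.log a < d := by
    have h3 := Real.log_lt_log hz0 (hz.trans_le (min_le_right _ _))
    rw [Real.log_mul ha0.ne' (Real.exp_pos d).ne', Real.log_exp] at h3
    linarith
  have h4 : 0 < Real.log ‖z‖ - Real.log a := sub_pos.2 (Real.log_lt_log ha0 hza)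
  have h5 : Real.exp (u z) * ‖z‖ ≤ Real.exp (u z) :=
    mul_le_of_le_one_right (Real.exp_pos _).le (hzρ.trans hρ1).le
  have h6 : R ≤ 2 * d * Real.exp (u z) :=
    h1.trans (mul_le_mul (by linarith) h5 (by positivity) (by positivity))
  have h7 : R * Real.exp K ≤ R * Real.exp (u z) := by
    calc R * Real.exp K ≤ 2 * d * Real.exp (u z) * Real.exp K := by gcongr
      _ = R * Real.exp (u z) := by rw [hd]; field_simp
  exact Real.exp_le_exp.1 (le_of_mul_le_mul_left h7 hR0)

end ConformalAnnulus

end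

theorem mainTheorem1 (a : ℝ) (ha0 : 0 < a) (ha1 : a < 1) (u : ℂ → ℝ)
    (hu : ContinuousOn u (ConformalAnnulus.annulus a))
    (hu2 : ContDiffOn ℝ 2 u (ConformalAnnulus.openAnnulus a))
    (hflat : ConformalAnnulus.IsFlat a u)
    (hwidth : 0 < ConformalAnnulus.width a u) :
    ¬ ConformalAnnulus.IsCompleteMetric a u := by
  exact ConformalAnnulus.not_isCompleteMetric_of_isFlat ha0 ha1 hu hu2 hflat
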